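/- Let $X$ be a compact complex manifold of dimension $n$ (for instance a projective manifold), let $L$ be a holomorphic line bundle over $X$, let $\phi_0$ be a smooth metric on $L$ with $i\partial\bar\partial\phi_0>0$ (so that $L$ is a positive line bundle), and let $\phi$ be a possibly singular metric on $L$ with $i\partial\bar\partial\phi\ge 0$, normalized so that $\phi\le\phi_0$. Metrics are identified with their local weights: the weights of $\phi$ are plurisubharmonic functions with values in $[-\infty,\infty)$, not identically $-\infty$ on any nonempty open set. For $s\ge 0$ put $\phi_s:=\max(\phi+s,\phi_0)$. Let $k\ge 0$ be an integer and let $\sigma\in H^0(X,K_X+kL)$. With $c_n=i^{n^2}$, define the following elements of $[0,\infty]$: $$\|\sigma\|^2:=c_n\int_X\sigma\wedge\bar\sigma\,e^{-(\phi-\phi_0)-k\phi_0},\qquad \|\sigma\|_s^2:=c_n\int_X\sigma\wedge\bar\sigma\,e^{-2(\phi_s-\phi_0)-k\phi_0}\quad(s\ge 0).$$ Then $$2\|\sigma\|^2=\int_0^\infty e^s\|\sigma\|_s^2\,ds+\|\sigma\|_0^2 ,$$ and more generally, for every real $p$ with $0<p<2$, $$\frac{2}{p(2-p)}\;c_n\int_X\sigma\wedge\bar\sigma\,e^{-p(\phi-\phi_0)-k\phi_0}=\int_0^\infty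 e^{ps}\|\sigma\|_s^2\,ds+\frac1p\|\sigma\|_0^2 .$$ Both are identities in $[0,\infty]$: one side is infinite if and only if the other is. -/

import Mathlib

open Set MeasureTheory Bundle
open scoped Manifold ContDiff ENNReal TensorProduct

noncomputable section

namespace LineBundle

/-! ### Plurisubharmonic functions on open subsets of `ℂⁿ` -/

/-- The mean of an extended-real function over the circle `θ ↦ a + e^{iθ} b`, namely the mean of its
positive part minus the mean of its negative part.  For functions that are bounded above on the
circle the first mean is finite, so this is the usual integral with values in `[-∞, ∞)`. -/
def circleMean {n : ℕ} (u : (Fin n → ℂ) → EReal) (a b : Fin n → ℂ) : EReal :=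
  ((laverage (volume.restrict (Ioc (0 : ℝ) (2 * Real.pi)))
      fun θ => (u (a + Complex.exp (θ * Complex.I) • b)).toENNReal : ℝ≥0∞) : EReal)
    - ((laverage (volume.restrict (Ioc (0 : ℝ) (2 * Real.pi)))
      fun θ => (-u (a + Complex.exp (θ * Complex.I) • b)).toENNReal : ℝ≥0∞) : EReal)

/-- `u : U → [-∞, ∞)` is plurisubharmonic on the open set `U ⊆ ℂⁿ`: it is upper semicontinuous and
has the sub-mean value property on every closed complex disc in `U`. -/
structure IsPlurisubharmonicOn {n : ℕ} (u : (Fin n → ℂ) → EReal) (U : Set (Fin n → ℂ)) :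
    Prop where
  lt_top : ∀ z ∈ U, u z < ⊤
  upperSemicontinuousOn : UpperSemicontinuousOn u U
  le_circleMean : ∀ a b : Fin n → ℂ, (∀ ζ : ℂ, ‖ζ‖ ≤ 1 → a + ζ • b ∈ U) → u a ≤ circleMean u a b

/-- The Levi form `∑ ∂²u/∂z_j∂z̄_k (z) b_j b̄_k` of a real function on `ℂⁿ`, written through the real
second derivative as `(D²u(b, b) + D²u(ib, ib)) / 4`. -/
def leviForm {n : ℕ} (u : (Fin n → ℂ) → ℝ) (z b : Fin n → ℂ) : ℝ :=
  (iteratedFDeriv ℝ 2 u z ![b, b]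
    + iteratedFDeriv ℝ 2 u z ![Complex.I • b, Complex.I • b]) / 4

/-! ### Metrics on a holomorphic line bundle

A metric on the line bundle `L` is written additively: to a nonzero vector `v ∈ L_x` it assigns the
weight `φ(v)`, where `|v|² = e^{-φ(v)}`.  The local weight of the metric in a holomorphic
trivialization `e` is its value on the frame `x ↦ e.symm x 1`.  The value at `v = 0` is irrelevant. -/

section Metrics

variable (n : ℕ) {X : Type*} [TopologicalSpace X] [ChartedSpace (Fin n → ℂ) X]
  (L : X → Type*) [∀ x, AddCommGroup (L x)] [∀ x, Module ℂ (L x)]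
  [∀ x, TopologicalSpace (L x)] [TopologicalSpace (TotalSpace ℂ L)] [FiberBundle ℂ L]

/-- A possibly singular metric `φ` on `L` with `i∂∂̄φ ≥ 0`: its local weights are plurisubharmonic,
and it is not identically `-∞` on any nonempty open set (equivalently, given plurisubharmonicity,
the local weights are locally integrable). -/
structure SemipositiveMetric where
  weight : ∀ x, L x → EReal
  weight_smul : ∀ (x : X) (c : ℂ) (v : L x), c ≠ 0 → v ≠ 0 →
    weight x (c • v) = weight x v - ((Real.log (‖c‖ ^ 2) : ℝ) : EReal)
  plurisubharmonic : ∀ c ∈ atlas (Fin n → ℂ) X,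
    ∀ (e : Trivialization ℂ (TotalSpace.proj : TotalSpace ℂ L → X)) [MemTrivializationAtlas e],
      IsPlurisubharmonicOn (fun z => weight (c.symm z) (e.symm (c.symm z) 1))
        (c.target ∩ c.symm ⁻¹' e.baseSet)
  dense_ne_bot : Dense {x : X | ∀ v : L x, v ≠ 0 → weight x v ≠ ⊥}

/-- A smooth metric on `L` with `i∂∂̄φ₀ > 0`: its local weights are real-valued and smooth and have
positive definite Levi form. -/
structure SmoothPositiveMetric where
  weight : ∀ x, L x → ℝ
  weight_smul : ∀ (x : X) (c : ℂ) (v : L x), c ≠ 0 → v ≠ 0 →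
    weight x (c • v) = weight x v - Real.log (‖c‖ ^ 2)
  contDiffOn : ∀ c ∈ atlas (Fin n → ℂ) X,
    ∀ (e : Trivialization ℂ (TotalSpace.proj : TotalSpace ℂ L → X)) [MemTrivializationAtlas e],
      ContDiffOn ℝ ∞ (fun z => weight (c.symm z) (e.symm (c.symm z) 1))
        (c.target ∩ c.symm ⁻¹' e.baseSet)
  leviForm_pos : ∀ c ∈ atlas (Fin n → ℂ) X,
    ∀ (e : Trivialization ℂ (TotalSpace.proj : TotalSpace ℂ L → X)) [MemTrivializationAtlas e],
      ∀ z ∈ c.target ∩ c.symm ⁻¹' e.baseSet, ∀ b : Fin n → ℂ, b ≠ 0 →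
        0 < leviForm (fun z => weight (c.symm z) (e.symm (c.symm z) 1)) z b

end Metrics

/-! ### Holomorphic sections of `K_X + kL` -/

section Sections

variable {n : ℕ} {X : Type*} [TopologicalSpace X] [ChartedSpace (Fin n → ℂ) X]
  (L : X → Type*) [∀ x, AddCommGroup (L x)] [∀ x, Module ℂ (L x)]
  [∀ x, TopologicalSpace (L x)] [TopologicalSpace (TotalSpace ℂ L)] [FiberBundle ℂ L]
  [VectorBundle ℂ ℂ L]

/-- Not necessarily continuous sections of `K_X + kL`: `(n, 0)`-forms on `X` with values in the
`k`-th tensor power of `L`. -/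
abbrev RoughSection (n : ℕ) {X : Type*} [TopologicalSpace X] [ChartedSpace (Fin n → ℂ) X]
    (L : X → Type*) [∀ x, AddCommGroup (L x)] [∀ x, Module ℂ (L x)] (k : ℕ) : Type _ :=
  ∀ x : X, (TangentSpace 𝓘(ℂ, Fin n → ℂ) x) [⋀^Fin n]→ₗ[ℂ] (⨂[ℂ] _i : Fin k, L x)

variable {L}

/-- The linear form on `L_x^{⊗k}` induced by a trivialization `e` of `L`:
`v₁ ⊗ ⋯ ⊗ v_k ↦ e(v₁) ⋯ e(v_k)`.  Over the base set of `e` it is the coordinate with respect to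
the basis vector `(e.symm x 1)^{⊗k}`. -/
def tensorCoord (k : ℕ) (e : Trivialization ℂ (TotalSpace.proj : TotalSpace ℂ L → X))
    [MemTrivializationAtlas e] (x : X) : (⨂[ℂ] _i : Fin k, L x) →ₗ[ℂ] ℂ :=
  PiTensorProduct.lift
    ((MultilinearMap.mkPiAlgebra ℂ (Fin k) ℂ).compLinearMap fun _ => e.linearMapAt ℂ x)

/-- The coordinate vector field `∂/∂z_j` of the chart `c`, at the point with coordinates `z`. -/
def chartFrame (c : OpenPartialHomeomorph X (Fin n → ℂ)) (z : Fin n → ℂ) (j : Fin n) :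
    TangentSpace 𝓘(ℂ, Fin n → ℂ) (c.symm z) :=
  mfderiv 𝓘(ℂ, Fin n → ℂ) 𝓘(ℂ, Fin n → ℂ) c.symm z (Pi.single j (1 : ℂ) : Fin n → ℂ)

/-- The coefficient `h` of the section `σ = h dz₁ ∧ ⋯ ∧ dz_n ⊗ f^{⊗k}` in the chart `c` and the
trivialization `e` of `L` with frame `f`. -/
def localCoeff {k : ℕ} (σ : RoughSection n L k) (c : OpenPartialHomeomorph X (Fin n → ℂ))
    (e : Trivialization ℂ (TotalSpace.proj : TotalSpace ℂ L → X)) [MemTrivializationAtlas e]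
    (z : Fin n → ℂ) : ℂ :=
  tensorCoord k e (c.symm z) (σ (c.symm z) (chartFrame c z))

variable (n L)

/-- `H⁰(X, K_X + kL)`: the sections of `K_X + kL` all of whose local coefficients are
holomorphic. -/
def H0 (k : ℕ) : Submodule ℂ (RoughSection n L k) where
  carrier := {σ | ∀ c ∈ atlas (Fin n → ℂ) X,
    ∀ (e : Trivialization ℂ (TotalSpace.proj : TotalSpace ℂ L → X)) [MemTrivializationAtlas e],
      DifferentiableOn ℂ (localCoeff σ c e) (c.target ∩ c.symm ⁻¹' e.baseSet)}
  add_mem' := by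
    intro σ τ hσ hτ c hc e _
    have h : localCoeff (σ + τ) c e = localCoeff σ c e + localCoeff τ c e := by
      funext z
      simp [localCoeff]
    rw [h]
    exact (hσ c hc e).add (hτ c hc e)
  zero_mem' := by
    intro c hc e _
    have h : localCoeff (0 : RoughSection n L k) c e = fun _ => 0 := by
      funext z
      simp [localCoeff]
    rw [h]
    exact differentiableOn_const _
  smul_mem' := by
    intro a σ hσ c hc e _
    have h : localCoeff (a • σ) c e = a • localCoeff σ c e := by
      funext z
      simp [localCoeff]
    rw [h]
    exact (hσ c hc e).const_smul a

end Sections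

/-! ### Integration of nonnegative `(n, n)`-forms -/

section Integration

/-- A compact manifold is covered by finitely many of its preferred charts. -/
theorem exists_finite_chart_cover (n : ℕ) (X : Type*) [TopologicalSpace X] [CompactSpace X]
    [ChartedSpace (Fin n → ℂ) X] :
    ∃ (N : ℕ) (p : Fin N → X), ∀ x, ∃ i, x ∈ (chartAt (Fin n → ℂ) (p i)).source := by
  obtain ⟨t, ht⟩ := isCompact_univ.elim_finite_subcover
    (fun x : X => (chartAt (Fin n → ℂ) x).source)
    (fun x => (chartAt (Fin n → ℂ) x).open_source)
    (fun x _ => mem_iUnion.2 ⟨x, mem_chart_source _ x⟩)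
  refine ⟨t.card, fun i => (t.equivFin.symm i : X), fun x => ?_⟩
  obtain ⟨y, hy, hxy⟩ := mem_iUnion₂.1 (ht (mem_univ x))
  exact ⟨t.equivFin ⟨y, hy⟩, by simpa using hxy⟩

variable (n : ℕ) (X : Type*) [TopologicalSpace X] [CompactSpace X] [ChartedSpace (Fin n → ℂ) X]

/-- The number of charts in a fixed finite cover of `X`. -/
def coverCard : ℕ := (exists_finite_chart_cover n X).choose

/-- The charts of a fixed finite cover of `X`. -/
def coverChart (i : Fin (coverCard n X)) : OpenPartialHomeomorph X (Fin n → ℂ) :=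
  chartAt (Fin n → ℂ) ((exists_finite_chart_cover n X).choose_spec.choose i)

theorem exists_mem_coverChart_source (x : X) : ∃ i, x ∈ (coverChart n X i).source :=
  (exists_finite_chart_cover n X).choose_spec.choose_spec x

/-- The points of the `i`-th chart (in coordinates) that lie in none of the previous charts.  These
pieces correspond to a partition of `X` into Borel sets. -/
def coverPiece (i : Fin (coverCard n X)) : Set (Fin n → ℂ) :=
  {z ∈ (coverChart n X i).target |
    ∀ j < i, (coverChart n X i).symm z ∉ (coverChart n X j).source}

variable {n X}

/-- The integral over `X` of a nonnegative measurable `(n, n)`-form with values in `[0, ∞]`, where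
`α c` is the density of the form with respect to Lebesgue measure in the chart `c`: it is the sum of
the integrals over the pieces of a partition of `X` subordinate to an atlas.  By the change of
variables formula it does not depend on the partition, as soon as the densities transform as those
of a form. -/
def integralForm (α : OpenPartialHomeomorph X (Fin n → ℂ) → (Fin n → ℂ) → ℝ≥0∞) : ℝ≥0∞ :=
  ∑ i, ∫⁻ z in coverPiece n X i, α (coverChart n X i) z

end Integration

/-! ### `L²`-norms on `H⁰(X, K_X + kL)` -/

section Norms

variable {n : ℕ} {X : Type*} [TopologicalSpace X] [ChartedSpace (Fin n → ℂ) X]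
  {L : X → Type*} [∀ x, AddCommGroup (L x)] [∀ x, Module ℂ (L x)]
  [∀ x, TopologicalSpace (L x)] [TopologicalSpace (TotalSpace ℂ L)] [FiberBundle ℂ L]
  [VectorBundle ℂ ℂ L]

/-- The density in the chart `c` of the form `c_n σ ∧ σ̄ e^{-ψ}`, `c_n = i^{n²}`, where `ψ` is a
metric on `kL`, given through its weights `ψ(v)` with respect to the frames `v^{⊗k}` of `kL`.
If `σ = h dz ⊗ f^{⊗k}` in the chart, then `c_n dz ∧ dz̄ = ∏ (i dz_j ∧ dz̄_j)` is `2ⁿ` times Lebesgue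
measure, so the density is `2ⁿ |h|² e^{-ψ(f)}`; the frame `f` is that of the preferred
trivialization of `L` at the point. -/
def normDensity {k : ℕ} (σ : RoughSection n L k) (ψ : ∀ x, L x → EReal)
    (c : OpenPartialHomeomorph X (Fin n → ℂ)) (z : Fin n → ℂ) : ℝ≥0∞ :=
  2 ^ n * ‖localCoeff σ c (trivializationAt ℂ L (c.symm z)) z‖ₑ ^ 2
    * EReal.exp (-ψ (c.symm z) ((trivializationAt ℂ L (c.symm z)).symm (c.symm z) 1))

/-- `c_n ∫_X σ ∧ σ̄ e^{-ψ}`, an element of `[0, ∞]`. -/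
def sqNorm [CompactSpace X] {k : ℕ} (σ : RoughSection n L k) (ψ : ∀ x, L x → EReal) : ℝ≥0∞ :=
  integralForm (normDensity σ ψ)

/-- The metric `q (φ - φ₀) + k φ₀` on `kL`, for metrics `φ` and `φ₀` on `L` and real `q > 0`. -/
def twistedWeight (q : ℝ) (k : ℕ) (φ : ∀ x, L x → EReal) (φ₀ : ∀ x, L x → ℝ) :
    ∀ x, L x → EReal :=
  fun x v => (q : EReal) * (φ x v - (φ₀ x v : EReal)) + ((k * φ₀ x v : ℝ) : EReal)

/-- The regularized metric `φ_s = max (φ + s, φ₀)` on `L`. -/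
def regularize (φ : ∀ x, L x → EReal) (φ₀ : ∀ x, L x → ℝ) (s : ℝ) : ∀ x, L x → EReal :=
  fun x v => max (φ x v + (s : EReal)) (φ₀ x v : EReal)

/-- `c_n ∫_X σ ∧ σ̄ e^{-q(φ-φ₀)-kφ₀}`; for `q = 1` this is `‖σ‖²`. -/
def normSq [CompactSpace X] {k : ℕ} (φ : ∀ x, L x → EReal) (φ₀ : ∀ x, L x → ℝ) (q : ℝ)
    (σ : RoughSection n L k) : ℝ≥0∞ :=
  sqNorm σ (twistedWeight q k φ φ₀)

/-- `‖σ‖²_s = c_n ∫_X σ ∧ σ̄ e^{-2(φ_s-φ₀)-kφ₀}`. -/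
def regNormSq [CompactSpace X] {k : ℕ} (φ : ∀ x, L x → EReal) (φ₀ : ∀ x, L x → ℝ) (s : ℝ)
    (σ : RoughSection n L k) : ℝ≥0∞ :=
  sqNorm σ (twistedWeight 2 k (regularize φ φ₀ s) φ₀)

end Norms

end LineBundle

end

namespace LineBundle

/-! ### The one-dimensional integral -/

/-! The identity is pointwise on X, integrated by Tonelli. Put u = φ - φ₀ ≤ 0, a function on X
because changes of frame cancel, and let A be the density of c_n σ ∧ σ̄ e^{-kφ₀}. Then φ_s - φ₀ =
max(u + s, 0), and ‖σ‖₀² is the integral of A since max(u, 0) = 0. So it suffices to integrate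
e^{ps} e^{-2 max(u+s, 0)} over s > 0. With t = -u, the range s ≤ t gives (e^{pt} - 1)/p and s > t
gives e^{pt}/(2 - p). Adding 1/p leaves (1/p + 1/(2-p)) e^{pt} = 2/(p(2-p)) e^{-pu}; this 1/p is the
coefficient of ‖σ‖₀². `setLIntegral_Ioi_exp_mul_exp_max` is this identity, `lintegral_mul_exp_eq`
the Tonelli step, and `normDensity_twistedWeight` with `relativeWeight_regularize` expresses every
norm through A and u. Semicontinuity of φ and continuity of φ₀ and σ supply the measurability. -/

theorem setLIntegral_Ioi_ofReal_exp_mul_exp_max {p t : ℝ} (hp : 0 < p) (hp2 : p < 2)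
    (ht : 0 ≤ t) :
    (∫⁻ s in Ioi (0 : ℝ), ENNReal.ofReal (Real.exp (p * s) * Real.exp (-(2 * max (-t + s) 0))))
        + ENNReal.ofReal (1 / p)
      = ENNReal.ofReal (2 / (p * (2 - p)) * Real.exp (p * t)) := by
  have hq : p - 2 < 0 := by linarith
  have hleft : ∫⁻ s in Ioc (0 : ℝ) t,
      ENNReal.ofReal (Real.exp (p * s) * Real.exp (-(2 * max (-t + s) 0)))
        = ENNReal.ofReal ((Real.exp (p * t) - 1) / p) := by
    rw [setLIntegral_congr_fun measurableSet_Ioc (g := fun s => ENNReal.ofReal (Real.exp (p * s)))]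
    · rw [← ofReal_integral_eq_lintegral_ofReal]
      · rw [← intervalIntegral.integral_of_le ht,
          intervalIntegral.integral_comp_mul_left (fun x => Real.exp x) hp.ne', integral_exp]
        simp [div_eq_inv_mul]
      · exact (by fun_prop : Continuous fun s : ℝ => Real.exp (p * s)).integrableOn_Ioc
      · exact Filter.Eventually.of_forall fun s => (Real.exp_pos _).le
    · intro s hs
      have : max (-t + s) 0 = 0 := max_eq_right (by linarith [hs.2])
      simp [this]
  -- Past s = t the integrand is e^{2t} e^{(p-2)s}, integrable at infinity because p < 2.
  have hright : ∫⁻ s in Ioi t,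
      ENNReal.ofReal (Real.exp (p * s) * Real.exp (-(2 * max (-t + s) 0)))
        = ENNReal.ofReal (Real.exp (p * t) / (2 - p)) := by
    rw [setLIntegral_congr_fun measurableSet_Ioi
      (g := fun s => ENNReal.ofReal (Real.exp (2 * t) * Real.exp ((p - 2) * s)))]
    · rw [← ofReal_integral_eq_lintegral_ofReal]
      · rw [integral_const_mul, integral_exp_mul_Ioi hq, mul_div_assoc', mul_neg, ← Real.exp_add,
          neg_div, ← div_neg]
        ring_nf
      · exact (integrableOn_exp_mul_Ioi hq t).const_mul _
      · exact Filter.Eventually.of_forall fun s => (by positivity)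
    · intro s hs
      have : max (-t + s) 0 = -t + s := max_eq_left (by linarith [mem_Ioi.1 hs])
      simp only [this, ← Real.exp_add]
      ring_nf
  have h1 : 0 ≤ Real.exp (p * t) - 1 := by
    linarith [Real.one_le_exp (mul_nonneg hp.le ht)]
  have h2 : 0 < 2 - p := by linarith
  rw [← Ioc_union_Ioi_eq_Ioi ht, lintegral_union measurableSet_Ioi
    (disjoint_left.2 fun x hx hx' => not_lt.2 hx.2 hx'), hleft, hright,
    ← ENNReal.ofReal_add (by positivity) (by positivity),
    ← ENNReal.ofReal_add (by positivity) (by positivity)]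
  congr 1
  field_simp
  ring

/-- Allowing u = -∞ makes the identity hold at every point, so the pole set of φ need not be shown
to be null. -/
theorem setLIntegral_Ioi_exp_mul_exp_max {p : ℝ} (hp : 0 < p) (hp2 : p < 2) {u : EReal}
    (hu : u ≤ 0) :
    ENNReal.ofReal (2 / (p * (2 - p))) * EReal.exp (-((p : EReal) * u))
      = (∫⁻ s in Ioi (0 : ℝ), ENNReal.ofReal (Real.exp (p * s))
            * EReal.exp (-(((2 : ℝ) : EReal) * max (u + (s : EReal)) 0)))
        + ENNReal.ofReal (1 / p) := by
  have h2 : 0 < 2 - p := by linarith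
  induction u with
  | bot =>
    -- At a pole the maximum is 0 for every s, and e^{ps} ≥ 1 on a half-line of infinite length:
    -- both sides are ∞.
    have htop : ∫⁻ s in Ioi (0 : ℝ), ENNReal.ofReal (Real.exp (p * s)) = ⊤ := by
      refine top_le_iff.1 ?_
      calc (⊤ : ℝ≥0∞) = ∫⁻ _ in Ioi (0 : ℝ), 1 := by simp
        _ ≤ _ := setLIntegral_mono' measurableSet_Ioi fun s hs => by
          rw [← ENNReal.ofReal_one]
          exact ENNReal.ofReal_le_ofReal (Real.one_le_exp (mul_nonneg hp.le (mem_Ioi.1 hs).le))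
    have hc : ENNReal.ofReal (2 / (p * (2 - p))) ≠ 0 := by
      rw [Ne, ENNReal.ofReal_eq_zero, not_le]
      positivity
    simp [EReal.coe_mul_bot_of_pos hp, ENNReal.mul_top hc, htop]
  | coe a =>
    have ha : a ≤ 0 := by exact_mod_cast hu
    have h := setLIntegral_Ioi_ofReal_exp_mul_exp_max hp hp2 (neg_nonneg.2 ha)
    have hL : EReal.exp (-((p : EReal) * (a : EReal))) = ENNReal.ofReal (Real.exp (p * -a)) := by
      rw [← EReal.coe_mul, ← EReal.coe_neg, EReal.exp_coe, mul_neg]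
    have hR : ∀ s : ℝ, EReal.exp (-(((2 : ℝ) : EReal) * max ((a : EReal) + (s : EReal)) 0))
        = ENNReal.ofReal (Real.exp (-(2 * max (- -a + s) 0))) := by
      intro s
      rw [neg_neg, ← EReal.exp_coe, EReal.coe_neg, EReal.coe_mul,
        EReal.coe_strictMono.monotone.map_max, EReal.coe_add, EReal.coe_zero]
    simp only [hL, hR, ← ENNReal.ofReal_mul (Real.exp_pos _).le]
    rw [h, ENNReal.ofReal_mul (by positivity)]
  | top => simp at hu

/-! ### A local criterion for measurability -/

/-- By the Lindelöf property countably many of the U cover T. The set T itself need not be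
measurable. -/
theorem aemeasurable_restrict_of_locally {α β : Type*} [TopologicalSpace α]
    [SecondCountableTopology α] [MeasurableSpace α] [MeasurableSpace β] {μ : Measure α}
    {f : α → β} {T : Set α}
    (h : ∀ z ∈ T, ∃ U : Set α, IsOpen U ∧ z ∈ U ∧ AEMeasurable f (μ.restrict U)) :
    AEMeasurable f (μ.restrict T) := by
  classical
  choose! U hUo hzU hU using h
  obtain ⟨S, hST, hS, hcov⟩ := TopologicalSpace.countable_cover_nhdsWithin
    (f := U) (s := T) fun z hz => mem_nhdsWithin_of_mem_nhds ((hUo z hz).mem_nhds (hzU z hz))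
  have := hS.to_subtype
  rw [biUnion_eq_iUnion] at hcov
  exact (AEMeasurable.iUnion fun z : S => hU z (hST z.2)).mono_measure
    (Measure.restrict_mono hcov le_rfl)

/-! ### Change of frame -/

section Frames

variable {n : ℕ} {X : Type*} [TopologicalSpace X] [ChartedSpace (Fin n → ℂ) X]
  {L : X → Type*} [∀ x, AddCommGroup (L x)] [∀ x, Module ℂ (L x)]
  [∀ x, TopologicalSpace (L x)] [TopologicalSpace (TotalSpace ℂ L)] [FiberBundle ℂ L]
  [VectorBundle ℂ ℂ L]

theorem symm_one_ne_zero
    (e : Trivialization ℂ (TotalSpace.proj : TotalSpace ℂ L → X)) [MemTrivializationAtlas e]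
    {x : X} (hx : x ∈ e.baseSet) : e.symm x 1 ≠ 0 := by
  intro h
  have := e.linearMapAt_symm (R := ℂ) hx 1
  rw [h, map_zero] at this
  exact zero_ne_one this

/-- The fibre is a line, so a is the e-coordinate of the frame of e'. Frames and coordinates change
by the same a in opposite directions, which is what makes the densities below frame-independent. -/
theorem exists_change_of_frame
    (e e' : Trivialization ℂ (TotalSpace.proj : TotalSpace ℂ L → X)) [MemTrivializationAtlas e]
    [MemTrivializationAtlas e'] {x : X} (hx : x ∈ e.baseSet) (hx' : x ∈ e'.baseSet) :
    ∃ a : ℂ, a ≠ 0 ∧ e'.symm x 1 = a • e.symm x 1 ∧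
      e.linearMapAt ℂ x = a • e'.linearMapAt ℂ x := by
  have key : e'.symm x 1 = (e.linearMapAt ℂ x (e'.symm x 1)) • e.symm x 1 := by
    conv_lhs => rw [← e.symm_linearMapAt (R := ℂ) hx (e'.symm x 1)]
    rw [← e.symmₗ_apply (R := ℂ) hx, ← e.symmₗ_apply (R := ℂ) hx, ← map_smul, smul_eq_mul, mul_one]
  refine ⟨e.linearMapAt ℂ x (e'.symm x 1), ?_, key, ?_⟩
  · intro h
    rw [h, zero_smul] at key
    exact symm_one_ne_zero e' hx' key
  · ext v
    have hv : v = (e'.linearMapAt ℂ x v) • e'.symm x 1 := by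
      conv_lhs => rw [← e'.symm_linearMapAt (R := ℂ) hx' v]
      rw [← e'.symmₗ_apply (R := ℂ) hx', ← e'.symmₗ_apply (R := ℂ) hx', ← map_smul, smul_eq_mul, mul_one]
    conv_lhs => rw [hv]
    rw [map_smul, smul_eq_mul, LinearMap.smul_apply, smul_eq_mul, mul_comm]

theorem tensorCoord_eq_smul (k : ℕ)
    (e e' : Trivialization ℂ (TotalSpace.proj : TotalSpace ℂ L → X)) [MemTrivializationAtlas e]
    [MemTrivializationAtlas e'] {x : X} {a : ℂ}
    (h : e.linearMapAt ℂ x = a • e'.linearMapAt ℂ x) :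
    tensorCoord k e x = a ^ k • tensorCoord k e' x := by
  refine PiTensorProduct.ext (MultilinearMap.ext fun v => ?_)
  simp [tensorCoord, h, Finset.prod_mul_distrib]

/-- The density of `c_n σ ∧ σ̄ e^{-kφ₀}` in the chart `c`, computed in the trivialization `e`. -/
noncomputable def baseDensity {k : ℕ} (σ : RoughSection n L k) (φ₀ : ∀ x, L x → ℝ)
    (c : OpenPartialHomeomorph X (Fin n → ℂ))
    (e : Trivialization ℂ (TotalSpace.proj : TotalSpace ℂ L → X)) [MemTrivializationAtlas e]
    (z : Fin n → ℂ) : ℝ≥0∞ :=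
  2 ^ n * ‖localCoeff σ c e z‖ₑ ^ 2
    * ENNReal.ofReal (Real.exp (-(k * φ₀ (c.symm z) (e.symm (c.symm z) 1))))

/-- The function `φ - φ₀` in the chart `c`, computed in the trivialization `e`. -/
noncomputable def relativeWeight (φ : ∀ x, L x → EReal) (φ₀ : ∀ x, L x → ℝ)
    (c : OpenPartialHomeomorph X (Fin n → ℂ))
    (e : Trivialization ℂ (TotalSpace.proj : TotalSpace ℂ L → X)) (z : Fin n → ℂ) : EReal :=
  φ (c.symm z) (e.symm (c.symm z) 1) - (φ₀ (c.symm z) (e.symm (c.symm z) 1) : EReal)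

/-- The factor |a|^{2k} comes from the coefficient of σ on one side and from e^{-kφ₀} on the other.
-/
theorem baseDensity_eq {k : ℕ} (σ : RoughSection n L k) (φ₀ : SmoothPositiveMetric n L)
    (c : OpenPartialHomeomorph X (Fin n → ℂ))
    (e e' : Trivialization ℂ (TotalSpace.proj : TotalSpace ℂ L → X)) [MemTrivializationAtlas e]
    [MemTrivializationAtlas e'] {z : Fin n → ℂ} (hx : c.symm z ∈ e.baseSet)
    (hx' : c.symm z ∈ e'.baseSet) :
    baseDensity σ φ₀.weight c e z = baseDensity σ φ₀.weight c e' z := by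
  obtain ⟨a, ha, hframe, hcoord⟩ := exists_change_of_frame e e' hx hx'
  have hna : 0 < ‖a‖ := norm_pos_iff.2 ha
  have hloc : localCoeff σ c e z = a ^ k * localCoeff σ c e' z := by
    simp [localCoeff, tensorCoord_eq_smul k e e' hcoord]
  have hexp : ∀ r : ℝ, Real.exp (-(k * (r - Real.log (‖a‖ ^ 2))))
      = (‖a‖ ^ k) ^ 2 * Real.exp (-(k * r)) := by
    intro r
    rw [show -(k * (r - Real.log (‖a‖ ^ 2))) = k * Real.log (‖a‖ ^ 2) + -(k * r) by ring,
      Real.exp_add, Real.exp_nat_mul, Real.exp_log (by positivity)]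
    ring
  unfold baseDensity
  rw [hloc, hframe, φ₀.weight_smul _ a _ ha (symm_one_ne_zero e hx), hexp,
    ENNReal.ofReal_mul (by positivity), ENNReal.ofReal_pow (by positivity),
    ENNReal.ofReal_pow (by positivity), ofReal_norm, enorm_mul, enorm_pow]
  ring

theorem relativeWeight_eq (φ : SemipositiveMetric n L) (φ₀ : SmoothPositiveMetric n L)
    (c : OpenPartialHomeomorph X (Fin n → ℂ))
    (e e' : Trivialization ℂ (TotalSpace.proj : TotalSpace ℂ L → X)) [MemTrivializationAtlas e]
    [MemTrivializationAtlas e'] {z : Fin n → ℂ} (hx : c.symm z ∈ e.baseSet)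
    (hx' : c.symm z ∈ e'.baseSet) :
    relativeWeight φ.weight φ₀.weight c e z = relativeWeight φ.weight φ₀.weight c e' z := by
  obtain ⟨a, ha, hframe, -⟩ := exists_change_of_frame e e' hx hx'
  unfold relativeWeight
  rw [hframe, φ₀.weight_smul _ a _ ha (symm_one_ne_zero e hx),
    φ.weight_smul _ a _ ha (symm_one_ne_zero e hx)]
  generalize φ.weight (c.symm z) (e.symm (c.symm z) 1) = w
  induction w with
  | bot => simp [sub_eq_add_neg]
  | coe w => norm_cast; ring_nf
  | top => norm_cast

/-! ### Measurability of the densities in a chart -/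

theorem aemeasurable_baseDensity {k : ℕ} (σ : H0 n L k) (φ₀ : SmoothPositiveMetric n L)
    {c : OpenPartialHomeomorph X (Fin n → ℂ)} (hc : c ∈ atlas (Fin n → ℂ) X) :
    AEMeasurable (fun z => baseDensity σ.1 φ₀.weight c (trivializationAt ℂ L (c.symm z)) z)
      (volume.restrict c.target) := by
  -- The preferred trivialization varies with the point without any regularity; near z it is
  -- replaced by the fixed one at z, by invariance under change of frame.
  refine aemeasurable_restrict_of_locally fun z hz => ?_
  set e := trivializationAt ℂ L (c.symm z)
  have hU : IsOpen (c.target ∩ c.symm ⁻¹' e.baseSet) :=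
    c.symm.isOpen_inter_preimage e.open_baseSet
  refine ⟨_, hU, ⟨hz, mem_baseSet_trivializationAt ℂ L _⟩, ?_⟩
  have hcoeff := ((σ.2 c hc e).continuousOn.aemeasurable hU.measurableSet (μ := volume))
  have hweight := ((φ₀.contDiffOn c hc e).continuousOn.aemeasurable hU.measurableSet
    (μ := volume))
  have h : AEMeasurable (baseDensity σ.1 φ₀.weight c e)
      (volume.restrict (c.target ∩ c.symm ⁻¹' e.baseSet)) :=
    ((hcoeff.enorm.pow_const 2).const_mul _).mul
      (Real.measurable_exp.comp_aemeasurable (hweight.const_mul _).neg).ennreal_ofReal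
  refine h.congr ?_
  filter_upwards [ae_restrict_mem hU.measurableSet] with w hw
  exact baseDensity_eq σ.1 φ₀ c _ _ hw.2 (mem_baseSet_trivializationAt ℂ L _)

theorem aemeasurable_relativeWeight (φ : SemipositiveMetric n L) (φ₀ : SmoothPositiveMetric n L)
    {c : OpenPartialHomeomorph X (Fin n → ℂ)} (hc : c ∈ atlas (Fin n → ℂ) X) :
    AEMeasurable (fun z => relativeWeight φ.weight φ₀.weight c
      (trivializationAt ℂ L (c.symm z)) z) (volume.restrict c.target) := by
  refine aemeasurable_restrict_of_locally fun z hz => ?_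
  set e := trivializationAt ℂ L (c.symm z)
  have hU : IsOpen (c.target ∩ c.symm ⁻¹' e.baseSet) :=
    c.symm.isOpen_inter_preimage e.open_baseSet
  refine ⟨_, hU, ⟨hz, mem_baseSet_trivializationAt ℂ L _⟩, ?_⟩
  have hφ := aemeasurable_restrict_of_measurable_subtype (μ := volume)
    (f := fun z => φ.weight (c.symm z) (e.symm (c.symm z) 1)) hU.measurableSet
    (upperSemicontinuousOn_iff_restrict.2
      (φ.plurisubharmonic c hc e).upperSemicontinuousOn).measurable
  have hφ₀ := ((φ₀.contDiffOn c hc e).continuousOn.aemeasurable hU.measurableSet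
    (μ := volume))
  have h : AEMeasurable (relativeWeight φ.weight φ₀.weight c e)
      (volume.restrict (c.target ∩ c.symm ⁻¹' e.baseSet)) :=
    hφ.add (continuous_neg.measurable.comp_aemeasurable hφ₀.coe_real_ereal)
  refine h.congr ?_
  filter_upwards [ae_restrict_mem hU.measurableSet] with w hw
  exact relativeWeight_eq φ φ₀ c _ _ hw.2 (mem_baseSet_trivializationAt ℂ L _)

theorem normDensity_twistedWeight {k : ℕ} (σ : RoughSection n L k) (q : ℝ) (φ : ∀ x, L x → EReal)
    (φ₀ : ∀ x, L x → ℝ) (c : OpenPartialHomeomorph X (Fin n → ℂ)) (z : Fin n → ℂ) :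
    normDensity σ (twistedWeight q k φ φ₀) c z
      = baseDensity σ φ₀ c (trivializationAt ℂ L (c.symm z)) z
        * EReal.exp (-((q : EReal)
            * relativeWeight φ φ₀ c (trivializationAt ℂ L (c.symm z)) z)) := by
  unfold normDensity twistedWeight baseDensity relativeWeight
  -- The summand kφ₀ is real, so no ∞ - ∞ arises when the sum is negated.
  rw [EReal.neg_add (Or.inr (EReal.coe_ne_top _)) (Or.inr (EReal.coe_ne_bot _)), sub_eq_add_neg,
    EReal.exp_add, ← EReal.coe_neg, EReal.exp_coe]
  ring

end Frames

theorem relativeWeight_regularize {n : ℕ} {X : Type*} [TopologicalSpace X] {L : X → Type*}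
    [∀ x, AddCommGroup (L x)] [TopologicalSpace (TotalSpace ℂ L)]
    (φ : ∀ x, L x → EReal) (φ₀ : ∀ x, L x → ℝ) (s : ℝ)
    (c : OpenPartialHomeomorph X (Fin n → ℂ))
    (e : Trivialization ℂ (TotalSpace.proj : TotalSpace ℂ L → X)) (z : Fin n → ℂ) :
    relativeWeight (regularize φ φ₀ s) φ₀ c e z
      = max (relativeWeight φ φ₀ c e z + (s : EReal)) 0 := by
  unfold relativeWeight regularize
  generalize φ (c.symm z) (e.symm (c.symm z) 1) = w
  generalize φ₀ (c.symm z) (e.symm (c.symm z) 1) = r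
  induction w with
  | bot => simp [sub_eq_add_neg, ← EReal.coe_neg, ← EReal.coe_add]
  | coe w =>
    have : max (w + s) r - r = max (w - r + s) 0 := by
      rw [← max_sub_sub_right]
      ring_nf
    have h := congrArg Real.toEReal this
    rw [EReal.coe_sub, EReal.coe_strictMono.monotone.map_max,
      EReal.coe_strictMono.monotone.map_max] at h
    simpa using h
  | top => norm_cast

/-! ### Integration over the parameter -/

/-- Tonelli's theorem for the regularized densities, in terms of `A`, the density of
`c_n σ ∧ σ̄ e^{-kφ₀}`, and `u = φ - φ₀`. -/
theorem lintegral_mul_exp_eq {α : Type*} [MeasurableSpace α] {μ : Measure α} [SFinite μ]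
    {A : α → ℝ≥0∞} {u : α → EReal} (hA : AEMeasurable A μ) (hu : AEMeasurable u μ)
    (hu0 : ∀ z, u z ≤ 0) {p : ℝ} (hp : 0 < p) (hp2 : p < 2) :
    AEMeasurable (fun s : ℝ => ENNReal.ofReal (Real.exp (p * s)) * ∫⁻ z, A z
        * EReal.exp (-(((2 : ℝ) : EReal) * max (u z + (s : EReal)) 0)) ∂μ)
      (volume.restrict (Ioi 0)) ∧
    ENNReal.ofReal (2 / (p * (2 - p))) * ∫⁻ z, A z * EReal.exp (-((p : EReal) * u z)) ∂μ
      = (∫⁻ s in Ioi (0 : ℝ), ENNReal.ofReal (Real.exp (p * s))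
          * ∫⁻ z, A z * EReal.exp (-(((2 : ℝ) : EReal) * max (u z + (s : EReal)) 0)) ∂μ)
        + ENNReal.ofReal (1 / p)
          * ∫⁻ z, A z * EReal.exp (-(((2 : ℝ) : EReal) * max (u z + ((0 : ℝ) : EReal)) 0)) ∂μ := by
  set ν : Measure ℝ := volume.restrict (Ioi 0)
  have hneg : Measurable fun x : EReal => EReal.exp (-x) :=
    EReal.measurable_exp.comp continuous_neg.measurable
  have hE : AEMeasurable (fun y : ℝ × α =>
      EReal.exp (-(((2 : ℝ) : EReal) * max (u y.2 + (y.1 : EReal)) 0))) (ν.prod μ) :=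
    hneg.comp_aemeasurable ((((hu.comp_snd).add
      measurable_fst.coe_real_ereal.aemeasurable).max aemeasurable_const).const_mul _)
  have hAE : AEMeasurable (fun y : ℝ × α => A y.2
      * EReal.exp (-(((2 : ℝ) : EReal) * max (u y.2 + (y.1 : EReal)) 0))) (ν.prod μ) :=
    hA.comp_snd.mul hE
  have hexp : Measurable fun s : ℝ => ENNReal.ofReal (Real.exp (p * s)) := by fun_prop
  refine ⟨hexp.aemeasurable.mul hAE.lintegral_prod_right', ?_⟩
  have hF : AEMeasurable (fun y : ℝ × α => ENNReal.ofReal (Real.exp (p * y.1)) * (A y.2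
      * EReal.exp (-(((2 : ℝ) : EReal) * max (u y.2 + (y.1 : EReal)) 0)))) (ν.prod μ) :=
    (hexp.comp measurable_fst).aemeasurable.mul hAE
  have hswap : (∫⁻ s, ENNReal.ofReal (Real.exp (p * s))
        * ∫⁻ z, A z * EReal.exp (-(((2 : ℝ) : EReal) * max (u z + (s : EReal)) 0)) ∂μ ∂ν)
      = ∫⁻ z, A z * ∫⁻ s, ENNReal.ofReal (Real.exp (p * s))
          * EReal.exp (-(((2 : ℝ) : EReal) * max (u z + (s : EReal)) 0)) ∂ν ∂μ := by
    simp_rw [← lintegral_const_mul' _ _ ENNReal.ofReal_ne_top]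
    rw [lintegral_lintegral_swap hF]
    refine lintegral_congr fun z => ?_
    -- A z may be infinite here, so moving it across the integral uses measurability in s.
    rw [← lintegral_const_mul]
    · exact lintegral_congr fun s => by ring
    · exact hexp.mul (hneg.comp (((measurable_const.add
        measurable_id.coe_real_ereal).max measurable_const).const_mul _))
  have hzero : ∀ z, EReal.exp (-(((2 : ℝ) : EReal) * max (u z + ((0 : ℝ) : EReal)) 0)) = 1 := by
    intro z
    rw [EReal.coe_zero, add_zero, max_eq_right (hu0 z)]
    simp
  simp only [hzero, mul_one]
  rw [hswap, ← lintegral_const_mul' _ _ ENNReal.ofReal_ne_top,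
    ← lintegral_const_mul' _ _ ENNReal.ofReal_ne_top,
    ← lintegral_add_right' _ (hA.const_mul _)]
  refine lintegral_congr fun z => ?_
  rw [mul_left_comm, setLIntegral_Ioi_exp_mul_exp_max hp hp2 (hu0 z), mul_add,
    mul_comm (A z) (ENNReal.ofReal _)]

/-! ### Summation over the pieces of the partition -/

theorem coverPiece_subset_target {n : ℕ} {X : Type*} [TopologicalSpace X] [CompactSpace X]
    [ChartedSpace (Fin n → ℂ) X] (i : Fin (coverCard n X)) :
    coverPiece n X i ⊆ (coverChart n X i).target :=
  fun _ hz => hz.1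

theorem ofReal_mul_normSq_eq {n : ℕ} {X : Type*} [TopologicalSpace X] [CompactSpace X]
    [ChartedSpace (Fin n → ℂ) X] {L : X → Type*} [∀ x, AddCommGroup (L x)] [∀ x, Module ℂ (L x)]
    [∀ x, TopologicalSpace (L x)] [TopologicalSpace (TotalSpace ℂ L)] [FiberBundle ℂ L]
    [VectorBundle ℂ ℂ L] (φ : SemipositiveMetric n L) (φ₀ : SmoothPositiveMetric n L)
    (hφ : ∀ (x : X) (v : L x), v ≠ 0 → φ.weight x v ≤ (φ₀.weight x v : EReal))
    {k : ℕ} (σ : H0 n L k) {p : ℝ} (hp : 0 < p) (hp2 : p < 2) :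
    ENNReal.ofReal (2 / (p * (2 - p))) * normSq φ.weight φ₀.weight p σ.1
      = (∫⁻ s in Ioi (0 : ℝ), ENNReal.ofReal (Real.exp (p * s))
            * regNormSq φ.weight φ₀.weight s σ.1)
        + ENNReal.ofReal (1 / p) * regNormSq φ.weight φ₀.weight 0 σ.1 := by
  have key := fun i : Fin (coverCard n X) =>
    have hc : coverChart n X i ∈ atlas (Fin n → ℂ) X := chart_mem_atlas _ _
    have hle := Measure.restrict_mono (μ := volume) (coverPiece_subset_target i) le_rfl
    lintegral_mul_exp_eq ((aemeasurable_baseDensity σ φ₀ hc).mono_measure hle)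
      ((aemeasurable_relativeWeight φ φ₀ hc).mono_measure hle)
      -- The sign holds for all z, even off the chart target, since a preferred trivialization is
      -- always defined at its own base point.
      (fun z => EReal.sub_nonpos.2
        (hφ _ _ (symm_one_ne_zero _ (mem_baseSet_trivializationAt ℂ L _)))) hp hp2
  simp only [normSq, regNormSq, sqNorm, integralForm, normDensity_twistedWeight,
    relativeWeight_regularize, Finset.mul_sum]
  -- The measurability half of `key` lets the finite sum leave the s-integral.
  rw [lintegral_finsetSum' _ fun i _ => (key i).1, ← Finset.sum_add_distrib]
  exact Finset.sum_congr rfl fun i _ => (key i).2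

end LineBundle


theorem proposition2p1 {n : ℕ} {X : Type*} [TopologicalSpace X] [T2Space X] [CompactSpace X]
    [ChartedSpace (Fin n → ℂ) X] [IsManifold 𝓘(ℂ, Fin n → ℂ) ω X]
    (L : X → Type*) [∀ x, AddCommGroup (L x)] [∀ x, Module ℂ (L x)]
    [∀ x, TopologicalSpace (L x)] [TopologicalSpace (TotalSpace ℂ L)] [FiberBundle ℂ L]
    [VectorBundle ℂ ℂ L] [ContMDiffVectorBundle ω ℂ L 𝓘(ℂ, Fin n → ℂ)]
    (φ : LineBundle.SemipositiveMetric n L) (φ₀ : LineBundle.SmoothPositiveMetric n L)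
    (hφ : ∀ (x : X) (v : L x), v ≠ 0 → φ.weight x v ≤ (φ₀.weight x v : EReal))
    (k : ℕ) (σ : LineBundle.H0 n L k) :
    2 * LineBundle.normSq φ.weight φ₀.weight 1 σ.1
        = (∫⁻ s in Ioi (0 : ℝ), ENNReal.ofReal (Real.exp s)
              * LineBundle.regNormSq φ.weight φ₀.weight s σ.1)
          + LineBundle.regNormSq φ.weight φ₀.weight 0 σ.1
    ∧ ∀ p : ℝ, 0 < p → p < 2 →
        ENNReal.ofReal (2 / (p * (2 - p))) * LineBundle.normSq φ.weight φ₀.weight p σ.1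
          = (∫⁻ s in Ioi (0 : ℝ), ENNReal.ofReal (Real.exp (p * s))
                * LineBundle.regNormSq φ.weight φ₀.weight s σ.1)
            + ENNReal.ofReal (1 / p) * LineBundle.regNormSq φ.weight φ₀.weight 0 σ.1 := by
  have main := fun (p : ℝ) (hp : 0 < p) (hp2 : p < 2) =>
    LineBundle.ofReal_mul_normSq_eq φ φ₀ hφ σ hp hp2
  refine ⟨?_, main⟩
  have h := main 1 one_pos one_lt_two
  norm_num at h
  exact h
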